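/- **Setting.** Let $d\ge 1$, and let $\lambda_b,\upsilon,\alpha,\mu,\Omega,\eta>0$. A transmitter sits at the origin of $\mathbb R^d$. The legitimate receivers are the points $X_0,X_1,X_2,\dots$ (enumerated in any order) of a homogeneous Poisson point process on $\mathbb R^d$ of density $\lambda_b$. The (total) channel power gains $g_0,g_1,\dots$ of the receivers are i.i.d., independent of the sequence $(X_i)_i$, and follow the $\alpha$-$\mu$ fading law with density $$f(x)=\frac{\alpha\,x^{\alpha\mu/2-1}}{2\,\Omega^{\alpha\mu/2}\,\Gamma(\mu)}\exp\!\Big(-\big(x/\Omega\big)^{\alpha/2}\Big)\quad(x>0),\qquad f(x)=0\quad(x\le 0)$$ (for instance $\Omega=\Gamma(\mu)/\Gamma(\mu+2/\alpha)$, which gives unit mean). With $r_i=\|X_i\|$ put $\xi_i=r_i^{\upsilon}/g_i$. For $k\ge 1$, the $k$-th best receiver is the receiver $i$ for which exactly $k-1$ receivers $j$ satisfy $\xi_j<\xi_i$. Its connection outage probability at rate $R_t$ is $$\mathcal P_{co,B}(R_t)=\Pr\Big(\log_2\big(1+\eta\,g_i/r_i^{\upsilon}\big)<R_t \text{ for the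 } k\text{-th best receiver } i\Big).$$ Here $\eta=\eta_k$ is the ratio of transmit power to receiver noise power. **Proposition.** For every integer $k\ge1$ and every $R_t>0$, almost surely there is exactly one $k$-th best receiver, and $$\mathcal P_{co,B}(R_t)=\frac{\Gamma\big(k,\,A_{b1}\Delta^{-\delta}\big)}{\Gamma(k)},\qquad \Delta=\frac{2^{R_t}-1}{\eta},\quad \delta=\frac d\upsilon,$$ where $\Gamma(a,x)=\int_x^\infty t^{a-1}e^{-t}\,dt$ is the upper incomplete gamma function and $$A_{b1}=\frac{A_{b0}}{\delta},\qquad A_{b0}=\frac{\lambda_b\,c_d\,\delta\,\Omega^{\delta}\,\Gamma(\mu+2\delta/\alpha)}{\Gamma(\mu)},\qquad c_d=\frac{\pi^{d/2}}{\Gamma(1+d/2)}.$$ -/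

import Mathlib

open MeasureTheory ProbabilityTheory Set

noncomputable section

namespace SecrecyCOP

/-- The upper incomplete gamma function `Γ(a, x) = ∫_x^∞ t^(a-1) e^(-t) dt`. -/
def upperGamma (a x : ℝ) : ℝ := ∫ t in Ioi x, t ^ (a - 1) * Real.exp (-t)

/-- The constant `c_d = π^(d/2) / Γ(1 + d/2)`. -/
def ballConst (d : ℕ) : ℝ := Real.pi ^ ((d : ℝ) / 2) / Real.Gamma (1 + (d : ℝ) / 2)

/-- The density of the channel power gain under `α`-`μ` fading with scale `w`. -/
def alphaMuPDF (α μ w x : ℝ) : ℝ :=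
  if 0 < x then
    α * x ^ (α * μ / 2 - 1) / (2 * w ^ (α * μ / 2) * Real.Gamma μ)
      * Real.exp (-(x / w) ^ (α / 2))
  else 0

/-- The law on the real line with density `alphaMuPDF α μ w`. -/
def alphaMuMeasure (α μ w : ℝ) : Measure ℝ :=
  volume.withDensity (fun x => ENNReal.ofReal (alphaMuPDF α μ w x))

/-- The number of points of the enumerated point process `X` that lie in `B`. -/
def pointCount {Ω E : Type*} (X : ℕ → Ω → E) (B : Set E) (ω : Ω) : ℕ∞ :=
  {i : ℕ | X i ω ∈ B}.encard

/-- The random points `X 0, X 1, …` (in any order) form a homogeneous Poisson point process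
of density `lam` on `d`-dimensional Euclidean space. -/
structure IsHPPP {Ω : Type*} [MeasurableSpace Ω] (P : Measure Ω) {d : ℕ}
    (X : ℕ → Ω → EuclideanSpace ℝ (Fin d)) (lam : ℝ) : Prop where
  measurable : ∀ i, Measurable (X i)
  count_law : ∀ B : Set (EuclideanSpace ℝ (Fin d)), MeasurableSet B → volume B ≠ ⊤ →
    ∀ n : ℕ, P.real {ω | pointCount X B ω = n} =
      Real.exp (-(lam * volume.real B)) * (lam * volume.real B) ^ n / (n.factorial : ℝ)
  count_indep : ∀ (m : ℕ) (B : Fin m → Set (EuclideanSpace ℝ (Fin d))),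
    (∀ j, MeasurableSet (B j)) → Pairwise (fun i j => Disjoint (B i) (B j)) →
      iIndepFun (fun j => pointCount X (B j)) P

/-- The path loss with fading `ξ_i = r_i^υ / g_i` of the `i`-th receiver, where `r_i` is its
distance from the transmitter at the origin and `g_i` its channel power gain. -/
def pathLoss {Ω : Type*} {d : ℕ} (X : ℕ → Ω → EuclideanSpace ℝ (Fin d)) (g : ℕ → Ω → ℝ)
    (υ : ℝ) (i : ℕ) (ω : Ω) : ℝ := ‖X i ω‖ ^ υ / g i ω

/-- Receiver `i` is the `k`-th best one (`k ≥ 1`): exactly `k - 1` receivers have a strictly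
smaller value of `ξ`. -/
def IsKthBest (ξ : ℕ → ℝ) (k i : ℕ) : Prop := {j : ℕ | ξ j < ξ i}.encard + 1 = k

/-- The capacity `log₂ (1 + η g_i / r_i^υ)` of the link to the `i`-th receiver. -/
def capacity {Ω : Type*} {d : ℕ} (X : ℕ → Ω → EuclideanSpace ℝ (Fin d)) (g : ℕ → Ω → ℝ)
    (υ η : ℝ) (i : ℕ) (ω : Ω) : ℝ := Real.logb 2 (1 + η * g i ω / ‖X i ω‖ ^ υ)

/-- The connection outage probability of the `k`-th best receiver at rate `Rt`: the probability
that the capacity of the link to the `k`-th best receiver is below `Rt`. -/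
def copBest {Ω : Type*} [MeasurableSpace Ω] (P : Measure Ω) {d : ℕ}
    (X : ℕ → Ω → EuclideanSpace ℝ (Fin d)) (g : ℕ → Ω → ℝ) (υ η : ℝ) (k : ℕ) (Rt : ℝ) : ℝ :=
  P.real {ω | ∃ i, IsKthBest (fun j => pathLoss X g υ j ω) k i ∧ capacity X g υ η i ω < Rt}

/-- The constant `A_{b0} = λ_b c_d δ Ω^δ Γ(μ + 2δ/α) / Γ(μ)` with `Ω = w`. -/
def Ab0 (d : ℕ) (lam α μ w δ : ℝ) : ℝ :=
  lam * ballConst d * δ * w ^ δ * Real.Gamma (μ + 2 * δ / α) / Real.Gamma μ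

/-- The constant `A_{b1} = A_{b0} / δ`. -/
def Ab1 (d : ℕ) (lam α μ w δ : ℝ) : ℝ := Ab0 d lam α μ w δ / δ

end SecrecyCOP

end

noncomputable section

open Filter Topology
open scoped ENNReal

namespace SecrecyCOP

/-! Let `N T` count the receivers with loss at most `T`. The `k`-th best loss exceeds `T` exactly
when `N T < k`, and outage means that this loss exceeds `Δ⁻¹`. So it suffices that `N T` is Poisson
with mean `A_{b1} T^δ`: the Poisson tail at `T = Δ⁻¹` is the incomplete gamma quotient
(`upperGamma_nat_div_Gamma`).

The Poisson law of `N T` is the marking theorem for the pairs `(X i, g i)`. It is derived from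
counts on disjoint sets through Laplace functionals: `E exp(-∑ f(X i)) = exp(-λ ∫ (1 - e^{-f}))`
holds for simple `f`, then by monotone limits for measurable `f` (`IsHPPP.lintegral_negExp`).
Averaging over independent gains replaces `e^{-f(x,y)}` by its mean `q(x) = e^{-h(x)}`, so the
unmarked formula for `h` gives the marked one (`IsHPPP.lintegral_negExp_marked`). An indicator
multiple for `f` gives a Poisson Laplace transform, which determines the law
(`poisson_of_lintegral_negExp`). The mean is `λ` times the integral over the gain `y` of the volume
of a ball of radius `(T y)^{1/υ}`, hence the `δ`-th moment of the fading law.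

A `k`-th best receiver exists because the counts `N T` are finite, and is unique because atomless
gains and nonzero positions exclude ties. -/

/-! ### The exponential `e^{-a}` on `[0, ∞]`. -/

/-- The function `a ↦ e^{-a}` on `[0, ∞]`. -/
def negExp (a : ℝ≥0∞) : ℝ≥0∞ := (EReal.exp (a : EReal))⁻¹

lemma continuous_negExp : Continuous negExp :=
  continuous_inv.comp (ENNReal.continuous_exp.comp continuous_coe_ennreal_ereal)

lemma measurable_negExp : Measurable negExp := continuous_negExp.measurable

@[simp] lemma negExp_zero : negExp 0 = 1 := by simp [negExp]

@[simp] lemma negExp_top : negExp ⊤ = 0 := by simp [negExp]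

lemma negExp_ofReal {x : ℝ} (hx : 0 ≤ x) :
    negExp (ENNReal.ofReal x) = ENNReal.ofReal (Real.exp (-x)) := by
  rw [negExp, EReal.coe_ennreal_ofReal, max_eq_left hx, EReal.exp_coe, Real.exp_neg,
    ENNReal.ofReal_inv_of_pos (Real.exp_pos x)]

lemma negExp_antitone : Antitone negExp := fun _ _ h =>
  ENNReal.inv_le_inv.2 (EReal.exp_monotone (EReal.coe_ennreal_le_coe_ennreal_iff.2 h))

lemma negExp_le_one (a : ℝ≥0∞) : negExp a ≤ 1 := by
  simpa using negExp_antitone (zero_le (a := a))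

lemma negExp_add (a b : ℝ≥0∞) : negExp (a + b) = negExp a * negExp b := by
  have h : ∀ a : ℝ≥0∞, EReal.exp (a : EReal) ≠ 0 := fun a => by simp
  rw [negExp, EReal.coe_ennreal_add, EReal.exp_add, ENNReal.mul_inv (.inl (h a)) (.inr (h b))]
  rfl

lemma negExp_sum {ι : Type*} (s : Finset ι) (f : ι → ℝ≥0∞) :
    negExp (∑ i ∈ s, f i) = ∏ i ∈ s, negExp (f i) := by
  classical
  induction s using Finset.induction_on with
  | empty => simp
  | insert a s ha ih => rw [Finset.sum_insert ha, Finset.prod_insert ha, negExp_add, ih]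

/-- Passes from finitely many points, where independence factors integrals, to all of them;
divergent sums are covered since `e^{-∞} = 0`. -/
lemma tendsto_prod_negExp (f : ℕ → ℝ≥0∞) :
    Tendsto (fun n => ∏ i ∈ Finset.range n, negExp (f i)) atTop (𝓝 (negExp (∑' i, f i))) := by
  simp_rw [← negExp_sum]
  exact (continuous_negExp.tendsto _).comp ENNReal.summable.hasSum.tendsto_sum_nat

lemma toENNReal_encard_setOf (p : ℕ → Prop) [DecidablePred p] :
    (({i | p i}.encard : ℕ∞) : ℝ≥0∞) = ∑' i, if p i then 1 else 0 := by
  rw [← ENNReal.tsum_set_one, tsum_subtype {i | p i} (fun _ => (1 : ℝ≥0∞))]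
  simp [indicator]

/-! ### Laplace transforms of counts and Poisson laws. -/

section

variable {Ω : Type*} [MeasurableSpace Ω]

lemma measurable_encard_setOf {p : ℕ → Ω → Prop} (hp : ∀ i, MeasurableSet {ω | p i ω}) :
    Measurable fun ω => {i | p i ω}.encard := by
  classical
  have h : Measurable fun ω => ∑' i, if p i ω then (1 : ℝ≥0∞) else 0 :=
    Measurable.tsum fun i => Measurable.ite (hp i) measurable_const measurable_const
  refine measurable_to_countable' fun n => ?_
  convert h (measurableSet_singleton (n : ℝ≥0∞)) using 1
  ext ω
  simp [← toENNReal_encard_setOf]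

variable {P : Measure Ω} {N : Ω → ℕ∞}

/-- The transform is the generating function at `s = e^{-c}`. Infinite counts contribute nothing,
because `c > 0` makes the integrand vanish there. -/
lemma lintegral_negExp_mul (hN : Measurable N) {c : ℝ} (hc : 0 < c) :
    ∫⁻ ω, negExp (ENNReal.ofReal c * (N ω : ℝ≥0∞)) ∂P =
      ∑' n : ℕ, ENNReal.ofReal (Real.exp (-c) ^ n) * P {ω | N ω = n} := by
  classical
  have hm : ∀ n : ℕ, MeasurableSet {ω | N ω = n} := fun n => hN (measurableSet_singleton (n : ℕ∞))
  have h : ∀ ω, negExp (ENNReal.ofReal c * (N ω : ℝ≥0∞)) =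
      ∑' n : ℕ, {ω | N ω = n}.indicator (fun _ => ENNReal.ofReal (Real.exp (-c) ^ n)) ω := by
    intro ω
    simp only [indicator, mem_ofPred_eq]
    cases hn : N ω with
    | top => simp [hc]
    | coe n =>
      have : ∀ m : ℕ, ((n : ℕ∞) = m) = (m = n) := fun m => by
        rw [Nat.cast_inj, eq_comm (a := n)]
      simp only [this, tsum_ite_eq]
      rw [ENat.toENNReal_coe, ← ENNReal.ofReal_natCast, ← ENNReal.ofReal_mul hc.le,
        negExp_ofReal (by positivity), ← Real.exp_nat_mul]
      ring_nf
  simp_rw [h]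
  rw [lintegral_tsum fun n => (measurable_const.indicator (hm n)).aemeasurable]
  exact tsum_congr fun n => lintegral_indicator_const (hm n) _

lemma hasSum_poisson (m s : ℝ) :
    HasSum (fun n : ℕ => s ^ n * (Real.exp (-m) * m ^ n / (n.factorial : ℝ)))
      (Real.exp (-(m * (1 - s)))) := by
  have h := (NormedSpace.expSeries_div_hasSum_exp (s * m)).mul_left (Real.exp (-m))
  rw [← Real.exp_eq_exp_ℝ, ← Real.exp_add] at h
  have e : -(m * (1 - s)) = -m + s * m := by ring
  rw [e]
  have e' : (fun n : ℕ => s ^ n * (Real.exp (-m) * m ^ n / (n.factorial : ℝ))) =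
      fun n => Real.exp (-m) * ((s * m) ^ n / (n.factorial : ℝ)) := by
    funext n
    rw [mul_pow]
    ring
  rw [e']
  exact h

/-- The Laplace transform of a Poisson distributed count. -/
lemma lintegral_negExp_of_poisson [IsFiniteMeasure P] (hN : Measurable N) {m : ℝ} (hm : 0 ≤ m)
    (h : ∀ n : ℕ, P.real {ω | N ω = n} = Real.exp (-m) * m ^ n / (n.factorial : ℝ))
    {c : ℝ} (hc : 0 < c) :
    ∫⁻ ω, negExp (ENNReal.ofReal c * (N ω : ℝ≥0∞)) ∂P =
      ENNReal.ofReal (Real.exp (-(m * (1 - Real.exp (-c))))) := by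
  rw [lintegral_negExp_mul hN hc, ← (hasSum_poisson m _).tsum_eq,
    ENNReal.ofReal_tsum_of_nonneg (fun n => by positivity) (hasSum_poisson m _).summable]
  refine tsum_congr fun n => ?_
  rw [ENNReal.ofReal_mul (by positivity), ← h n, Measure.real, ENNReal.ofReal_toReal (by simp)]

/-- Bounded power series that agree on `(0, 1)` have the same coefficients. -/
lemma eq_of_tsum_pow_eq {a b : ℕ → ℝ} {C : ℝ} (ha : ∀ n, |a n| ≤ C) (hb : ∀ n, |b n| ≤ C)
    (h : ∀ s ∈ Ioo (0 : ℝ) 1, ∑' n, s ^ n * a n = ∑' n, s ^ n * b n) : a = b := by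
  have key : ∀ c : ℕ → ℝ, (∀ n, |c n| ≤ C) →
      HasFPowerSeriesAt (fun s : ℝ => ∑' n, s ^ n * c n) (FormalMultilinearSeries.ofScalars ℝ c) 0 := by
    intro c hc
    refine ⟨1, ?_, by norm_num, ?_⟩
    · refine FormalMultilinearSeries.le_radius_of_bound _ C fun n => ?_
      simpa [FormalMultilinearSeries.ofScalars_norm] using hc n
    · intro y hy
      have hy1 : |y| < 1 := by
        rw [Metric.mem_eball, edist_zero_right, ← ofReal_norm, ENNReal.ofReal_lt_one] at hy
        exact hy
      have hs : Summable fun n => y ^ n * c n := by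
        refine Summable.of_norm_bounded ((summable_geometric_of_abs_lt_one
          (r := |y|) (by simpa using hy1)).mul_right C) fun n => ?_
        rw [norm_mul, norm_pow, Real.norm_eq_abs, Real.norm_eq_abs]
        exact mul_le_mul_of_nonneg_left (hc n) (by positivity)
      have := hs.hasSum
      rw [zero_add]
      simpa [FormalMultilinearSeries.ofScalars_apply_eq, mul_comm] using this
  have h1 := key a ha
  have h2 := key b hb
  -- The sums agree only to the right of `0`, but points accumulating at `0` are enough for the
  -- identity theorem.
  have hf : ∃ᶠ s in 𝓝[≠] (0 : ℝ), ∑' n, s ^ n * a n = ∑' n, s ^ n * b n := by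
    refine Frequently.filter_mono (f := 𝓝[>] (0 : ℝ)) (Eventually.frequently ?_)
      (nhdsWithin_mono _ fun x hx => ne_of_gt hx)
    filter_upwards [Ioo_mem_nhdsGT (zero_lt_one (α := ℝ))] with s hs using h s hs
  have he := (h1.analyticAt.frequently_eq_iff_eventually_eq h2.analyticAt).1 hf
  have := (h1.congr he).eq_formalMultilinearSeries h2
  exact FormalMultilinearSeries.ofScalars_series_injective ℝ ℝ this

/-- A count whose Laplace transform is that of a Poisson law has that Poisson law. -/
lemma poisson_of_lintegral_negExp [IsProbabilityMeasure P] (hN : Measurable N) {m : ℝ} (hm : 0 ≤ m)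
    (h : ∀ c : ℝ, 0 < c → ∫⁻ ω, negExp (ENNReal.ofReal c * (N ω : ℝ≥0∞)) ∂P =
      ENNReal.ofReal (Real.exp (-(m * (1 - Real.exp (-c)))))) (n : ℕ) :
    P.real {ω | N ω = n} = Real.exp (-m) * m ^ n / (n.factorial : ℝ) := by
  have hb : ∀ n : ℕ, Real.exp (-m) * m ^ n / (n.factorial : ℝ) ≤ 1 := fun n => by
    have h1 := hasSum_poisson m 1
    simp only [one_pow, one_mul, sub_self, mul_zero, neg_zero, Real.exp_zero] at h1
    exact le_hasSum h1 n fun _ _ => by positivity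
  refine congrFun (eq_of_tsum_pow_eq (a := fun n => P.real {ω | N ω = n})
    (b := fun n => Real.exp (-m) * m ^ n / (n.factorial : ℝ)) (C := 1) (fun n => ?_) (fun n => ?_)
    fun s hs => ?_) n
  · rw [abs_of_nonneg measureReal_nonneg]; exact measureReal_le_one
  · rw [abs_of_nonneg (by positivity)]; exact hb n
  -- The choice `c = -log s` turns `e^{-c}` into `s`.
  · have hc : 0 < -Real.log s := by have := Real.log_neg hs.1 hs.2; linarith
    have h1 := h _ hc
    rw [lintegral_negExp_mul hN hc, neg_neg, Real.exp_log hs.1] at h1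
    have h2 := congrArg ENNReal.toReal h1
    rw [ENNReal.tsum_toReal_eq fun n => ENNReal.mul_ne_top ENNReal.ofReal_ne_top (by simp),
      ENNReal.toReal_ofReal (by positivity)] at h2
    rw [(hasSum_poisson m s).tsum_eq, ← h2]
    refine tsum_congr fun n => ?_
    rw [ENNReal.toReal_mul, ENNReal.toReal_ofReal (pow_nonneg hs.1.le _)]; rfl

/-- The Poisson masses already sum to `1`, leaving none for `⊤`. -/
lemma ae_ne_top_of_poisson [IsProbabilityMeasure P] (hN : Measurable N) {m : ℝ}
    (h : ∀ n : ℕ, P.real {ω | N ω = n} = Real.exp (-m) * m ^ n / (n.factorial : ℝ)) :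
    ∀ᵐ ω ∂P, N ω ≠ ⊤ := by
  have hm : ∀ n : ℕ, MeasurableSet {ω | N ω = n} := fun n => hN (measurableSet_singleton (n : ℕ∞))
  have h1 := hasSum_poisson m 1
  simp only [one_pow, one_mul, sub_self, mul_zero, neg_zero, Real.exp_zero, ← h] at h1
  have h2 : P (⋃ n : ℕ, {ω | N ω = n}) = 1 := by
    rw [measure_iUnion (fun i j hij => by
      rw [Function.onFun, Set.disjoint_left]
      intro ω (hi : N ω = i) (hj : N ω = j)
      exact hij (by exact_mod_cast hi.symm.trans hj)) hm, ← ENNReal.ofReal_one, ← h1.tsum_eq,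
      ENNReal.ofReal_tsum_of_nonneg (fun n => measureReal_nonneg) h1.summable]
    exact tsum_congr fun n => by simp
  filter_upwards [compl_mem_ae_iff.2 ((prob_compl_eq_zero_iff (.iUnion hm)).2 h2)] with ω hω htop
  rw [compl_compl, mem_iUnion] at hω
  obtain ⟨n, hn⟩ := hω
  exact absurd (htop.symm.trans hn) (ENat.natCast_ne_top n).symm

end

/-! ### Laplace functional of the unmarked process. -/

/-- Viewing the points as a sum of Dirac masses makes sums over points into integrals, open to
simple functions and monotone convergence for each outcome. -/
lemma toENNReal_pointCount {Ω : Type*} {d : ℕ} (X : ℕ → Ω → EuclideanSpace ℝ (Fin d))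
    (B : Set (EuclideanSpace ℝ (Fin d))) (hB : MeasurableSet B) (ω : Ω) :
    (pointCount X B ω : ℝ≥0∞) = Measure.sum (fun i => Measure.dirac (X i ω)) B := by
  classical
  rw [Measure.sum_apply _ hB, pointCount, toENNReal_encard_setOf]
  refine tsum_congr fun i => ?_
  rw [Measure.dirac_apply' _ hB]
  simp [indicator]

section

variable {Ω : Type*} [MeasurableSpace Ω] {P : Measure Ω} {d : ℕ}
  {X : ℕ → Ω → EuclideanSpace ℝ (Fin d)} {lam : ℝ}

lemma IsHPPP.measurable_pointCount (hX : IsHPPP P X lam) {B : Set (EuclideanSpace ℝ (Fin d))}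
    (hB : MeasurableSet B) : Measurable (pointCount X B) :=
  measurable_encard_setOf fun i => hX.measurable i hB

variable [IsProbabilityMeasure P]

/-- The Laplace functional of a homogeneous Poisson process at a simple function that is finite and
supported on a set of finite volume. -/
lemma IsHPPP.lintegral_negExp_simpleFunc (hX : IsHPPP P X lam) (hlam : 0 ≤ lam)
    (f : SimpleFunc (EuclideanSpace ℝ (Fin d)) ℝ≥0∞) (hf : ∀ x, f x ≠ ⊤)
    (hfv : ∀ c ≠ 0, volume (f ⁻¹' {c}) ≠ ⊤) :
    ∫⁻ ω, negExp (∑' i, f (X i ω)) ∂P =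
      negExp (ENNReal.ofReal lam * ∫⁻ x, (1 - negExp (f x))) := by
  classical
  have hB : ∀ c, MeasurableSet (f ⁻¹' {c}) := fun c => f.measurableSet_fiber c
  have h1 : ∀ ω, ∑' i, f (X i ω) = ∑ c ∈ f.range, c * (pointCount X (f ⁻¹' {c}) ω : ℝ≥0∞) := by
    intro ω
    have h := f.lintegral_eq_lintegral (Measure.sum (fun i => Measure.dirac (X i ω)))
    rw [lintegral_sum_measure] at h
    simp_rw [lintegral_dirac' _ f.measurable] at h
    rw [h, SimpleFunc.lintegral]
    exact Finset.sum_congr rfl fun c _ => by rw [toENNReal_pointCount X _ (hB c)]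
  have hone : ∀ c ∈ f.range, ∫⁻ ω, negExp (c * (pointCount X (f ⁻¹' {c}) ω : ℝ≥0∞)) ∂P =
      negExp (ENNReal.ofReal lam * ((1 - negExp c) * volume (f ⁻¹' {c}))) := by
    intro c hc
    obtain ⟨x, rfl⟩ := SimpleFunc.mem_range.1 hc
    -- The zero fibre may have infinite volume, but both sides equal `1` there since `0 * ⊤ = 0`.
    rcases eq_or_ne (f x) 0 with h0 | h0
    · simp [h0]
    have hpos : 0 < (f x).toReal := ENNReal.toReal_pos h0 (hf x)
    have hvol := hfv _ h0
    have h := lintegral_negExp_of_poisson (hX.measurable_pointCount (hB (f x)))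
      (m := lam * volume.real (f ⁻¹' {f x})) (by positivity) (hX.count_law _ (hB _) hvol) hpos
    rw [ENNReal.ofReal_toReal (hf x)] at h
    have hle : 0 ≤ 1 - Real.exp (-(f x).toReal) := by simp
    rw [h, ← negExp_ofReal (by positivity), ENNReal.ofReal_mul (by positivity),
      ENNReal.ofReal_mul hlam, ENNReal.ofReal_sub _ (Real.exp_pos _).le, ← negExp_ofReal hpos.le,
      ENNReal.ofReal_toReal (hf x), ofReal_measureReal hvol, ENNReal.ofReal_one]
    ring_nf
  -- Distinct fibres are disjoint, so their counts are independent.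
  have hind : iIndepFun (fun c : f.range => pointCount X (f ⁻¹' {(c : ℝ≥0∞)})) P := by
    have h := hX.count_indep f.range.card (fun j => f ⁻¹' {(f.range.equivFin.symm j : ℝ≥0∞)})
      (fun j => hB _) (fun i j hij => Disjoint.preimage _ (by
        rw [disjoint_singleton]
        exact fun h => hij (f.range.equivFin.symm.injective (Subtype.ext h))))
    simpa using h.precomp f.range.equivFin.injective
  simp_rw [h1, negExp_sum]
  have h2 := lintegral_prod_eq_prod_lintegral_of_indepFun Finset.univ
    (fun (c : f.range) ω => negExp ((c : ℝ≥0∞) * (pointCount X (f ⁻¹' {(c : ℝ≥0∞)}) ω : ℝ≥0∞)))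
    (hind.comp (fun c n => negExp ((c : ℝ≥0∞) * (n : ℝ≥0∞))) fun c => measurable_of_countable _)
    (fun c => (measurable_of_countable
      (fun n : ℕ∞ => negExp ((c : ℝ≥0∞) * (n : ℝ≥0∞)))).comp (hX.measurable_pointCount (hB _)))
  simp_rw [Finset.univ_eq_attach] at h2
  rw [Finset.prod_attach f.range (fun c => ∫⁻ ω, negExp (c *
    (pointCount X (f ⁻¹' {c}) ω : ℝ≥0∞)) ∂P)] at h2
  have h3 : ∀ ω, ∏ c ∈ f.range.attach, negExp ((c : ℝ≥0∞) *
      (pointCount X (f ⁻¹' {(c : ℝ≥0∞)}) ω : ℝ≥0∞)) =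
      ∏ c ∈ f.range, negExp (c * (pointCount X (f ⁻¹' {c}) ω : ℝ≥0∞)) := fun ω =>
    Finset.prod_attach f.range (fun c => negExp (c * (pointCount X (f ⁻¹' {c}) ω : ℝ≥0∞)))
  simp_rw [h3] at h2
  rw [h2, Finset.prod_congr rfl hone, ← negExp_sum, ← Finset.mul_sum]
  congr 2
  have h4 := (f.map fun c => 1 - negExp c).lintegral_eq_lintegral volume
  rw [SimpleFunc.map_lintegral] at h4
  simpa using h4.symm

/-- The Laplace functional of a homogeneous Poisson process. -/
lemma IsHPPP.lintegral_negExp (hX : IsHPPP P X lam) (hlam : 0 ≤ lam)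
    {f : EuclideanSpace ℝ (Fin d) → ℝ≥0∞} (hf : Measurable f) :
    ∫⁻ ω, negExp (∑' i, f (X i ω)) ∂P =
      negExp (ENNReal.ofReal lam * ∫⁻ x, (1 - negExp (f x))) := by
  -- Restricting to balls gives the nonzero fibres finite volume, and `eapprox` takes only finite
  -- values.
  set F : ℕ → SimpleFunc (EuclideanSpace ℝ (Fin d)) ℝ≥0∞ := fun n =>
    (SimpleFunc.eapprox f n).restrict (Metric.ball 0 n) with hF
  have hFa : ∀ n x, F n x = (Metric.ball 0 (n : ℝ)).indicator (SimpleFunc.eapprox f n) x :=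
    fun n x => SimpleFunc.restrict_apply _ measurableSet_ball x
  have hmono : Monotone fun n => ⇑(F n) := by
    intro m n hmn x
    simp only [hFa]
    refine (indicator_le_indicator (SimpleFunc.monotone_eapprox f hmn x)).trans ?_
    exact indicator_le_indicator_of_subset (Metric.ball_subset_ball (by exact_mod_cast hmn))
      (fun _ => zero_le) x
  have hle : ∀ n x, F n x ≤ f x := fun n x => by
    rw [hFa]
    refine (indicator_le_self' (fun _ _ => zero_le) x).trans ?_
    rw [← SimpleFunc.iSup_eapprox_apply hf x]
    exact le_iSup (fun n => SimpleFunc.eapprox f n x) n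
  have hlim : ∀ x, Tendsto (fun n => F n x) atTop (𝓝 (f x)) := by
    intro x
    have h : Tendsto (fun n => SimpleFunc.eapprox f n x) atTop (𝓝 (f x)) := by
      rw [← SimpleFunc.iSup_eapprox_apply hf x]
      exact tendsto_atTop_iSup fun m n hmn => SimpleFunc.monotone_eapprox f hmn x
    refine h.congr' ?_
    obtain ⟨m, hm⟩ := exists_nat_gt ‖x‖
    filter_upwards [eventually_ge_atTop m] with n hn
    rw [hFa, indicator_of_mem]
    rw [mem_ball_zero_iff]
    exact hm.trans_le (by exact_mod_cast hn)
  have hsup : ∀ x, ⨆ n, F n x = f x := fun x =>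
    tendsto_nhds_unique (tendsto_atTop_iSup fun m n hmn => hmono hmn x) (hlim x)
  have hstep : ∀ n, ∫⁻ ω, negExp (∑' i, F n (X i ω)) ∂P =
      negExp (ENNReal.ofReal lam * ∫⁻ x, (1 - negExp (F n x))) := by
    intro n
    refine hX.lintegral_negExp_simpleFunc hlam (F n) (fun x => ?_) fun c hc => ?_
    · rw [hFa]
      refine ((indicator_le_self' (fun _ _ => zero_le) x).trans_lt
        (SimpleFunc.eapprox_lt_top f n x)).ne
    · refine ((measure_mono ?_).trans_lt (measure_ball_lt_top (x := 0) (r := (n : ℝ)))).ne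
      intro x hx
      by_contra hxb
      rw [mem_preimage, hFa, indicator_of_notMem hxb] at hx
      exact hc hx.symm
  have htsum : ∀ ω, Tendsto (fun n => ∑' i, F n (X i ω)) atTop (𝓝 (∑' i, f (X i ω))) := by
    intro ω
    have h := lintegral_tendsto_of_tendsto_of_monotone
      (μ := Measure.sum (fun i => Measure.dirac (X i ω))) (f := fun n => F n) (F := f)
      (fun n => (F n).measurable.aemeasurable) (ae_of_all _ fun x m n hmn => hmono hmn x)
      (ae_of_all _ hlim)
    simp_rw [lintegral_sum_measure] at h
    simpa only [lintegral_dirac' _ hf, lintegral_dirac' _ (F _).measurable] using h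
  have hL : Tendsto (fun n => ∫⁻ ω, negExp (∑' i, F n (X i ω)) ∂P) atTop
      (𝓝 (∫⁻ ω, negExp (∑' i, f (X i ω)) ∂P)) :=
    tendsto_lintegral_of_dominated_convergence (fun _ => 1)
      (fun n => measurable_negExp.comp
        (Measurable.tsum fun i => (F n).measurable.comp (hX.measurable i)))
      (fun n => ae_of_all _ fun ω => negExp_le_one _) (by simp)
      (ae_of_all _ fun ω => (continuous_negExp.tendsto _).comp (htsum ω))
  -- `1 - e^{-F n}` increases with `n`, so the limit passes even if the integral is infinite.
  have hR : Tendsto (fun n => ∫⁻ x, (1 - negExp (F n x))) atTop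
      (𝓝 (∫⁻ x, (1 - negExp (f x)))) :=
    lintegral_tendsto_of_tendsto_of_monotone
      (fun n => (measurable_const.sub (measurable_negExp.comp (F n).measurable)).aemeasurable)
      (ae_of_all _ fun x m n hmn => tsub_le_tsub_left (negExp_antitone (hmono hmn x)) _)
      (ae_of_all _ fun x => ENNReal.Tendsto.sub tendsto_const_nhds
        ((continuous_negExp.tendsto _).comp (hlim x)) (.inl ENNReal.one_ne_top))
  simp_rw [hstep] at hL
  exact tendsto_nhds_unique hL ((continuous_negExp.tendsto _).comp
    (ENNReal.Tendsto.const_mul hR (.inr ENNReal.ofReal_ne_top)))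

/-! ### Independent marks and thinning. -/

variable {g : ℕ → Ω → ℝ} {ν : Measure ℝ}

/-- Integrals with respect to the joint law of the points and the marks. -/
lemma lintegral_of_indepFun (hXm : ∀ i, Measurable (X i)) (hg : ∀ i, Measurable (g i))
    (hXg : IndepFun (fun ω i => X i ω) (fun ω i => g i ω) P)
    {F : (ℕ → EuclideanSpace ℝ (Fin d)) × (ℕ → ℝ) → ℝ≥0∞} (hF : Measurable F) :
    ∫⁻ ω, F (fun i => X i ω, fun i => g i ω) ∂P =
      ∫⁻ ω, ∫⁻ ω', F (fun i => X i ω, fun i => g i ω') ∂P ∂P := by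
  have hXm' : Measurable fun ω i => X i ω := measurable_pi_lambda _ hXm
  have hg' : Measurable fun ω i => g i ω := measurable_pi_lambda _ hg
  have h := (indepFun_iff_map_prod_eq_prod_map_map hXm'.aemeasurable hg'.aemeasurable).1 hXg
  have : IsProbabilityMeasure (P.map fun ω i => g i ω) :=
    Measure.isProbabilityMeasure_map hg'.aemeasurable
  rw [← lintegral_map hF (hXm'.prodMk hg'), h, lintegral_prod _ hF.aemeasurable,
    lintegral_map hF.lintegral_prod_right' hXm']
  refine lintegral_congr fun ω => ?_
  exact lintegral_map (hF.comp measurable_prodMk_left) hg'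

/-- The Laplace functional of an independently marked homogeneous Poisson process. -/
lemma IsHPPP.lintegral_negExp_marked (hX : IsHPPP P X lam) (hlam : 0 ≤ lam)
    (hg : ∀ i, Measurable (g i)) (hglaw : ∀ i, HasLaw (g i) ν P) (hgindep : iIndepFun g P)
    (hXg : IndepFun (fun ω i => X i ω) (fun ω i => g i ω) P)
    {f : EuclideanSpace ℝ (Fin d) × ℝ → ℝ≥0∞} (hf : Measurable f) {C : ℝ}
    (hfC : ∀ z, f z ≤ ENNReal.ofReal C) :
    ∫⁻ ω, negExp (∑' i, f (X i ω, g i ω)) ∂P =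
      negExp (ENNReal.ofReal lam * ∫⁻ x, ∫⁻ y, (1 - negExp (f (x, y))) ∂ν) := by
  have : IsProbabilityMeasure ν :=
    (hglaw 0).map_eq ▸ Measure.isProbabilityMeasure_map (hg 0).aemeasurable
  have hef : Measurable fun z => negExp (f z) := measurable_negExp.comp hf
  set q : EuclideanSpace ℝ (Fin d) → ℝ≥0∞ := fun x => ∫⁻ y, negExp (f (x, y)) ∂ν with hq
  have hqm : Measurable q := hef.lintegral_prod_right'
  have hq1 : ∀ x, q x ≤ 1 := fun x =>
    (lintegral_mono fun y => negExp_le_one _).trans (by simp)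
  -- The bound `C` on `f` keeps `q` at least `e^{-C⁺} > 0`, so that `-log q` is finite.
  have hq0 : ∀ x, q x ≠ 0 := by
    intro x
    have h : negExp (ENNReal.ofReal C) ≤ q x := by
      calc negExp (ENNReal.ofReal C) = ∫⁻ _, negExp (ENNReal.ofReal C) ∂ν := by simp
        _ ≤ q x := lintegral_mono fun y => negExp_antitone (hfC _)
    refine (lt_of_lt_of_le ?_ h).ne'
    rw [pos_iff_ne_zero, negExp, ENNReal.inv_ne_zero]
    simp
  have hqt : ∀ x, 0 < (q x).toReal := fun x =>
    ENNReal.toReal_pos (hq0 x) ((hq1 x).trans_lt ENNReal.one_lt_top).ne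
  set h : EuclideanSpace ℝ (Fin d) → ℝ≥0∞ := fun x => ENNReal.ofReal (-Real.log (q x).toReal)
  have hhm : Measurable h := (Real.measurable_log.comp hqm.ennreal_toReal).neg.ennreal_ofReal
  have hh : ∀ x, negExp (h x) = q x := by
    intro x
    have : Real.log (q x).toReal ≤ 0 := Real.log_nonpos (hqt x).le
      (by simpa using ENNReal.toReal_mono ENNReal.one_ne_top (hq1 x))
    rw [negExp_ofReal (by linarith), neg_neg, Real.exp_log (hqt x),
      ENNReal.ofReal_toReal ((hq1 x).trans_lt ENNReal.one_lt_top).ne]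
  -- With the positions frozen, the gains are independent and each factor integrates to `q (X i) =
  -- e^{-h (X i)}`.
  have hfin : ∀ n : ℕ, ∫⁻ ω, ∏ i ∈ Finset.range n, negExp (f (X i ω, g i ω)) ∂P =
      ∫⁻ ω, ∏ i ∈ Finset.range n, negExp (h (X i ω)) ∂P := by
    intro n
    have hF : Measurable fun z : (ℕ → EuclideanSpace ℝ (Fin d)) × (ℕ → ℝ) =>
        ∏ i ∈ Finset.range n, negExp (f (z.1 i, z.2 i)) :=
      Finset.measurable_prod _ fun i _ => hef.comp
        (((measurable_pi_apply i).comp measurable_fst).prodMk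
          ((measurable_pi_apply i).comp measurable_snd))
    rw [lintegral_of_indepFun hX.measurable hg hXg hF]
    refine lintegral_congr fun ω => ?_
    have hm : ∀ i, Measurable fun y => negExp (f (X i ω, y)) := fun i =>
      hef.comp measurable_prodMk_left
    rw [lintegral_prod_eq_prod_lintegral_of_indepFun (Finset.range n)
      (fun i ω' => negExp (f (X i ω, g i ω'))) (hgindep.comp _ hm) (fun i => (hm i).comp (hg i))]
    refine Finset.prod_congr rfl fun i _ => ?_
    rw [hh, ← lintegral_map (hm i) (hg i), (hglaw i).map_eq]
  have hdc : ∀ u : ℕ → Ω → ℝ≥0∞, (∀ i, Measurable (u i)) →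
      Tendsto (fun n => ∫⁻ ω, ∏ i ∈ Finset.range n, negExp (u i ω) ∂P) atTop
        (𝓝 (∫⁻ ω, negExp (∑' i, u i ω) ∂P)) := fun u hu =>
    tendsto_lintegral_of_dominated_convergence (fun _ => 1)
      (fun n => Finset.measurable_prod _ fun i _ => measurable_negExp.comp (hu i))
      (fun n => ae_of_all _ fun ω => Finset.prod_le_one' fun i _ => negExp_le_one _) (by simp)
      (ae_of_all _ fun ω => tendsto_prod_negExp _)
  have h1 := hdc (fun i ω => f (X i ω, g i ω)) fun i => hf.comp ((hX.measurable i).prodMk (hg i))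
  have h2 := hdc (fun i ω => h (X i ω)) fun i => hhm.comp (hX.measurable i)
  simp_rw [hfin] at h1
  rw [tendsto_nhds_unique h1 h2, hX.lintegral_negExp hlam hhm]
  congr 2
  refine lintegral_congr fun x => ?_
  have hm : Measurable fun y => negExp (f (x, y)) := hef.comp measurable_prodMk_left
  rw [hh, lintegral_sub hm ((hq1 x).trans_lt ENNReal.one_lt_top).ne (ae_of_all _ fun y => negExp_le_one _)]
  simp [hq]

/-- Independent thinning: the number of marked points in a set is Poisson distributed. -/
lemma IsHPPP.poisson_marked (hX : IsHPPP P X lam) (hlam : 0 ≤ lam)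
    (hg : ∀ i, Measurable (g i)) (hglaw : ∀ i, HasLaw (g i) ν P) (hgindep : iIndepFun g P)
    (hXg : IndepFun (fun ω i => X i ω) (fun ω i => g i ω) P)
    {S : Set (EuclideanSpace ℝ (Fin d) × ℝ)} (hS : MeasurableSet S) {m : ℝ} (hm : 0 ≤ m)
    (hSm : ENNReal.ofReal lam * (volume.prod ν) S = ENNReal.ofReal m) (n : ℕ) :
    P.real {ω | {i | (X i ω, g i ω) ∈ S}.encard = n} =
      Real.exp (-m) * m ^ n / (n.factorial : ℝ) := by
  classical
  have : IsProbabilityMeasure ν :=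
    (hglaw 0).map_eq ▸ Measure.isProbabilityMeasure_map (hg 0).aemeasurable
  refine poisson_of_lintegral_negExp (N := fun ω => {i | (X i ω, g i ω) ∈ S}.encard)
    (measurable_encard_setOf fun i => (hX.measurable i).prodMk (hg i) hS) hm (fun c hc => ?_) n
  have h := hX.lintegral_negExp_marked hlam hg hglaw hgindep hXg
    (f := S.indicator fun _ => ENNReal.ofReal c) (measurable_const.indicator hS) (C := c)
    (fun z => indicator_le_self' (fun _ _ => zero_le) z)
  have h1 : ∀ ω, ENNReal.ofReal c * ({i | (X i ω, g i ω) ∈ S}.encard : ℝ≥0∞) =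
      ∑' i, S.indicator (fun _ => ENNReal.ofReal c) (X i ω, g i ω) := fun ω => by
    rw [toENNReal_encard_setOf, ← ENNReal.tsum_mul_left]
    exact tsum_congr fun i => by simp [indicator]
  have h2 : ∀ z, 1 - negExp (S.indicator (fun _ => ENNReal.ofReal c) z) =
      S.indicator (fun _ => ENNReal.ofReal (1 - Real.exp (-c))) z := fun z => by
    by_cases hz : z ∈ S
    · simp [hz, negExp_ofReal hc.le, ENNReal.ofReal_sub _ (Real.exp_pos _).le]
    · simp [hz]
  have hle : 0 ≤ 1 - Real.exp (-c) := by simpa using hc.le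
  simp_rw [h1, h, h2]
  rw [← lintegral_prod _ (measurable_const.indicator hS).aemeasurable,
    lintegral_indicator_const hS, mul_left_comm, hSm, ← ENNReal.ofReal_mul hle,
    negExp_ofReal (by positivity)]
  ring_nf

end

/-! ### Ranking the losses. -/

lemma encard_setOf_lt_add_one (ξ : ℕ → ℝ) (i : ℕ) :
    {j | ξ j < ξ i}.encard + 1 = (insert i {j | ξ j < ξ i}).encard :=
  (encard_insert_of_notMem (by simp)).symm

/-- The `k`-th best receiver has loss exceeding `T` iff fewer than `k` losses are at most `T`. -/
lemma IsKthBest.lt_iff {ξ : ℕ → ℝ} {k i : ℕ} (h : IsKthBest ξ k i) (T : ℝ) :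
    T < ξ i ↔ {j | ξ j ≤ T}.encard < k := by
  unfold IsKthBest at h
  constructor
  · intro hT
    have h1 : {j | ξ j ≤ T}.encard ≤ {j | ξ j < ξ i}.encard :=
      encard_le_encard fun j (hj : ξ j ≤ T) => hj.trans_lt hT
    rw [← h]
    refine h1.trans_lt (ENat.lt_add_one_iff ?_ |>.2 le_rfl)
    intro htop
    rw [htop] at h
    simp at h
  · intro hlt
    by_contra! hT
    refine hlt.not_ge ?_
    -- If `ξ i ≤ T`, then `i` and its `k - 1` betters all have loss at most `T`.
    rw [← h, encard_setOf_lt_add_one]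
    refine encard_le_encard (insert_subset hT fun j hj => ?_)
    exact (le_of_lt (show ξ j < ξ i from hj)).trans hT

/-- If the losses are distinct and locally finite, there is exactly one `k`-th best receiver. -/
lemma existsUnique_isKthBest {ξ : ℕ → ℝ} (hinj : Function.Injective ξ)
    (hfin : ∀ n : ℕ, {i | ξ i ≤ n}.Finite) {k : ℕ} (hk : 1 ≤ k) : ∃! i, IsKthBest ξ k i := by
  have hfin' : ∀ T : ℝ, {i | ξ i ≤ T}.Finite := fun T => by
    obtain ⟨n, hn⟩ := exists_nat_ge T
    exact (hfin n).subset fun i (hi : ξ i ≤ T) => hi.trans hn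
  -- Only finitely many losses lie below that of any chosen element, so a minimum exists even over
  -- an infinite set.
  have hmin : ∀ A : Set ℕ, A.Nonempty → ∃ i ∈ A, ∀ j ∈ A, ξ i ≤ ξ j := by
    rintro A ⟨a, ha⟩
    obtain ⟨i, hi, him⟩ := exists_min_image {j ∈ A | ξ j ≤ ξ a} ξ
      ((hfin' (ξ a)).subset fun j hj => hj.2) ⟨a, ha, le_rfl⟩
    refine ⟨i, hi.1, fun j hj => ?_⟩
    rcases le_total (ξ j) (ξ a) with h | h
    · exact him j ⟨hj, h⟩
    · exact hi.2.trans h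
  have hex : ∀ m : ℕ, ∃ i, IsKthBest ξ (m + 1) i := by
    intro m
    induction m with
    | zero =>
      obtain ⟨i, -, hi⟩ := hmin univ univ_nonempty
      refine ⟨i, ?_⟩
      have : {j | ξ j < ξ i} = ∅ := eq_empty_of_forall_notMem fun j hj =>
        (hi j (mem_univ j)).not_gt hj
      simp [IsKthBest, this]
    | succ m ih =>
      obtain ⟨i, hi⟩ := ih
      have hne : {j | ξ i < ξ j}.Nonempty := by
        have := (hfin' (ξ i)).infinite_compl.nonempty
        obtain ⟨j, hj⟩ := this
        exact ⟨j, not_le.1 fun h : ξ j ≤ ξ i => hj h⟩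
      obtain ⟨l, hl, hlm⟩ := hmin _ hne
      refine ⟨l, ?_⟩
      -- As `l` minimizes the loss among those above `ξ i`, only `i` is added; distinctness of the
      -- losses rules out ties with `i`.
      have h1 : {j | ξ j < ξ l} = insert i {j | ξ j < ξ i} := by
        ext j
        constructor
        · intro (hj : ξ j < ξ l)
          rcases lt_trichotomy (ξ j) (ξ i) with h | h | h
          · exact .inr h
          · exact .inl (hinj h)
          · exact absurd hj (hlm j h).not_gt
        · rintro (rfl | hj)
          · exact hl
          · exact lt_trans (show ξ j < ξ i from hj) hl
      unfold IsKthBest at hi ⊢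
      rw [h1, ← encard_setOf_lt_add_one, hi]
      push_cast
      rfl
  obtain ⟨m, rfl⟩ : ∃ m, k = m + 1 := ⟨k - 1, by omega⟩
  obtain ⟨i, hi⟩ := hex m
  have key : ∀ a b, IsKthBest ξ (m + 1) a → IsKthBest ξ (m + 1) b → ξ a ≤ ξ b := by
    intro a b ha hb
    by_contra! h
    have h1 := (ha.lt_iff (ξ b)).1 h
    exact lt_irrefl _ ((hb.lt_iff (ξ b)).2 h1)
  exact ⟨i, hi, fun j hj => hinj (le_antisymm (key j i hj hi) (key i j hi hj))⟩

/-! ### Incomplete gamma function and Poisson tails. -/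

/-- The regularized upper incomplete gamma function at a positive integer is a Poisson tail. -/
lemma upperGamma_nat_div_Gamma {k : ℕ} (hk : 1 ≤ k) {x : ℝ} (hx : 0 ≤ x) :
    upperGamma k x / Real.Gamma k =
      ∑ j ∈ Finset.range k, Real.exp (-x) * x ^ j / (j.factorial : ℝ) := by
  obtain ⟨m, rfl⟩ : ∃ m, k = m + 1 := ⟨k - 1, by omega⟩
  -- An antiderivative of `t^m e^{-t}` vanishing at infinity; differentiating the sum telescopes.
  set F : ℝ → ℝ := fun t => -((m.factorial : ℝ) *
    ∑ j ∈ Finset.range (m + 1), Real.exp (-t) * t ^ j / (j.factorial : ℝ)) with hF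
  have hderiv : ∀ n : ℕ, ∀ t : ℝ, HasDerivAt
      (fun t => ∑ j ∈ Finset.range (n + 1), Real.exp (-t) * t ^ j / (j.factorial : ℝ))
      (-(Real.exp (-t) * t ^ n / (n.factorial : ℝ))) t := by
    intro n t
    have hexp : HasDerivAt (fun t : ℝ => Real.exp (-t)) (-Real.exp (-t)) t := by
      simpa using (hasDerivAt_neg t).exp
    induction n with
    | zero => simpa using hexp
    | succ n ih =>
      have h := ih.add ((hexp.mul (hasDerivAt_pow (n + 1) t)).div_const ((n + 1).factorial : ℝ))
      refine (h.congr_deriv ?_).congr_of_eventuallyEq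
        (.of_forall fun t => Finset.sum_range_succ _ (n + 1))
      rw [Nat.factorial_succ]
      have := n.factorial_ne_zero
      push_cast
      field_simp
      ring
  have hF' : ∀ t, HasDerivAt F (t ^ m * Real.exp (-t)) t := by
    intro t
    refine ((hderiv m t).const_mul (m.factorial : ℝ)).neg.congr_deriv ?_
    have := m.factorial_ne_zero
    field_simp
  have hlim : Tendsto F atTop (𝓝 0) := by
    have h : Tendsto (fun t : ℝ => -((m.factorial : ℝ) *
        ∑ j ∈ Finset.range (m + 1), Real.exp (-t) * t ^ j / (j.factorial : ℝ))) atTop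
        (𝓝 (-((m.factorial : ℝ) * ∑ j ∈ Finset.range (m + 1), 0 / (j.factorial : ℝ)))) := by
      refine ((tendsto_finsetSum _ fun j _ => Tendsto.div_const ?_ _).const_mul _).neg
      simpa [mul_comm] using Real.tendsto_pow_mul_exp_neg_atTop_nhds_zero j
    simpa using h
  have hint := integral_Ioi_of_hasDerivAt_of_nonneg (a := x) (hF' x).continuousAt.continuousWithinAt
    (fun t _ => hF' t) (fun t ht => by
      have : 0 ≤ t := hx.trans (le_of_lt ht)
      positivity) hlim
  have hu : upperGamma ((m + 1 : ℕ) : ℝ) x = 0 - F x := by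
    rw [← hint, upperGamma]
    refine setIntegral_congr_fun measurableSet_Ioi fun t _ => ?_
    simp
  rw [hu, Nat.cast_add_one, Real.Gamma_nat_eq_factorial, hF, zero_sub, neg_neg]
  have := m.factorial_ne_zero
  field_simp

/-! ### The fading law and the mean number of receivers below a loss. -/

lemma alphaMuPDF_nonneg {α μ w : ℝ} (hα : 0 < α) (hμ : 0 < μ) (hw : 0 < w) (x : ℝ) :
    0 ≤ alphaMuPDF α μ w x := by
  unfold alphaMuPDF
  split_ifs with h
  · have := Real.Gamma_pos_of_pos hμ
    positivity
  · exact le_rfl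

lemma measurable_alphaMuPDF (α μ w : ℝ) : Measurable (alphaMuPDF α μ w) := by
  unfold alphaMuPDF
  refine Measurable.ite measurableSet_Ioi ?_ measurable_const
  fun_prop

instance (α μ w : ℝ) : NullSingletonClass (alphaMuMeasure α μ w) where
  measure_singleton x := withDensity_absolutelyContinuous _ _ (measure_singleton x)

lemma ae_pos_alphaMuMeasure (α μ w : ℝ) : ∀ᵐ y ∂alphaMuMeasure α μ w, 0 < y := by
  rw [alphaMuMeasure, ae_withDensity_iff (measurable_alphaMuPDF α μ w).ennreal_ofReal]
  refine ae_of_all _ fun y hy => ?_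
  by_contra h
  simp [alphaMuPDF, h] at hy

/-- The moments of the `α`-`μ` fading law. -/
lemma lintegral_rpow_alphaMuMeasure {α μ w s : ℝ} (hα : 0 < α) (hμ : 0 < μ) (hw : 0 < w)
    (hs : 0 ≤ s) :
    ∫⁻ y, ENNReal.ofReal (y ^ s) ∂alphaMuMeasure α μ w =
      ENNReal.ofReal (w ^ s * Real.Gamma (μ + 2 * s / α) / Real.Gamma μ) := by
  have hΓ := Real.Gamma_pos_of_pos hμ
  have hΓ' : 0 < Real.Gamma (μ + 2 * s / α) := Real.Gamma_pos_of_pos (by positivity)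
  have hq : -1 < s + α * μ / 2 - 1 := by
    have : 0 < α * μ := by positivity
    linarith
  set D : ℝ := α / (2 * w ^ (α * μ / 2) * Real.Gamma μ) with hD
  have hDpos : 0 < D := by positivity
  set G : ℝ → ℝ := fun y => D * (y ^ (s + α * μ / 2 - 1) * Real.exp (-w ^ (-(α / 2)) * y ^ (α / 2)))
    with hG
  have hI : ∫ y in Ioi (0 : ℝ), G y = w ^ s * Real.Gamma (μ + 2 * s / α) / Real.Gamma μ := by
    rw [hG, integral_const_mul, integral_rpow_mul_exp_neg_mul_rpow (by positivity) hq
      (by positivity), ← Real.rpow_mul hw.le]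
    have e1 : -(α / 2) * (-(s + α * μ / 2 - 1 + 1) / (α / 2)) = s + α * μ / 2 := by
      field_simp
      ring
    have e2 : (s + α * μ / 2 - 1 + 1) / (α / 2) = μ + 2 * s / α := by
      field_simp
      ring
    rw [e1, e2, Real.rpow_add hw, hD]
    field_simp
  -- A non-integrable function would have Bochner integral `0`, while the computed value is
  -- positive.
  have hint : IntegrableOn G (Ioi 0) := by
    by_contra h
    have h0 := integral_undef h
    rw [hI] at h0
    have : 0 < w ^ s * Real.Gamma (μ + 2 * s / α) / Real.Gamma μ := by positivity
    exact this.ne' h0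
  have hnn : 0 ≤ᵐ[volume.restrict (Ioi 0)] G := by
    filter_upwards [ae_restrict_mem measurableSet_Ioi] with y hy
    have : 0 < y := hy
    simp only [hG, Pi.zero_apply]
    positivity
  rw [← hI, ofReal_integral_eq_lintegral_ofReal hint hnn, alphaMuMeasure,
    lintegral_withDensity_eq_lintegral_mul _ (measurable_alphaMuPDF α μ w).ennreal_ofReal
      (by fun_prop), ← lintegral_indicator measurableSet_Ioi]
  refine lintegral_congr fun y => ?_
  by_cases hy : 0 < y
  · rw [indicator_of_mem (show y ∈ Ioi (0 : ℝ) from hy), Pi.mul_apply,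
      ← ENNReal.ofReal_mul (alphaMuPDF_nonneg hα hμ hw y), alphaMuPDF, if_pos hy, hG, hD]
    have e1 : s + α * μ / 2 - 1 = s + (α * μ / 2 - 1) := by ring
    have e2 : -(y / w) ^ (α / 2) = -w ^ (-(α / 2)) * y ^ (α / 2) := by
      rw [Real.div_rpow hy.le hw.le, Real.rpow_neg hw.le]
      field_simp
    simp only [e2]
    rw [e1, Real.rpow_add hy]
    congr 1
    field_simp
  · rw [indicator_of_notMem (show y ∉ Ioi (0 : ℝ) from hy)]
    simp [alphaMuPDF, hy]

/-- The region of point-gain pairs whose path loss is at most `T`. -/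
def lossRegion (d : ℕ) (υ T : ℝ) : Set (EuclideanSpace ℝ (Fin d) × ℝ) :=
  {z | ‖z.1‖ ^ υ / z.2 ≤ T}

lemma measurableSet_lossRegion (d : ℕ) (υ T : ℝ) : MeasurableSet (lossRegion d υ T) :=
  measurableSet_le (by fun_prop) measurable_const

/-- For a fixed gain the slice is a ball of radius `(T y)^{1/υ}`; splitting off `y^δ` prepares the
moment formula. -/
lemma volume_lossRegion_slice {d : ℕ} (hd : 1 ≤ d) {υ T y : ℝ} (hυ : 0 < υ) (hT : 0 ≤ T)
    (hy : 0 < y) :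
    volume {x : EuclideanSpace ℝ (Fin d) | ‖x‖ ^ υ / y ≤ T} =
      ENNReal.ofReal (ballConst d * T ^ (d / υ)) * ENNReal.ofReal (y ^ (d / υ)) := by
  have : Nonempty (Fin d) := ⟨⟨0, hd⟩⟩
  have h1 : {x : EuclideanSpace ℝ (Fin d) | ‖x‖ ^ υ / y ≤ T} =
      Metric.closedBall 0 ((T * y) ^ υ⁻¹) := by
    ext x
    rw [mem_closedBall_zero_iff, mem_ofPred_eq, div_le_iff₀ hy,
      Real.le_rpow_inv_iff_of_pos (norm_nonneg x) (by positivity) hυ]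
  have hc : 0 ≤ ballConst d := by
    have := Real.Gamma_pos_of_pos (show (0 : ℝ) < 1 + (d : ℝ) / 2 by positivity)
    unfold ballConst
    positivity
  rw [h1, EuclideanSpace.volume_closedBall, Fintype.card_fin, ← ENNReal.ofReal_pow (by positivity),
    ← ENNReal.ofReal_mul (by positivity), ← ENNReal.ofReal_mul (by positivity)]
  congr 1
  have h2 : √Real.pi ^ d / Real.Gamma ((d : ℝ) / 2 + 1) = ballConst d := by
    rw [ballConst, add_comm 1, Real.sqrt_eq_rpow, ← Real.rpow_natCast, ← Real.rpow_mul Real.pi_pos.le]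
    ring_nf
  rw [h2, ← Real.rpow_natCast, ← Real.rpow_mul (by positivity), inv_mul_eq_div,
    Real.mul_rpow hT hy.le]
  ring

lemma measure_lossRegion {d : ℕ} (hd : 1 ≤ d) {lam υ T α μ w : ℝ} (hlam : 0 ≤ lam) (hυ : 0 < υ)
    (hT : 0 ≤ T) (hα : 0 < α) (hμ : 0 < μ) (hw : 0 < w) [SFinite (alphaMuMeasure α μ w)] :
    ENNReal.ofReal lam * (volume.prod (alphaMuMeasure α μ w)) (lossRegion d υ T) =
      ENNReal.ofReal (Ab1 d lam α μ w (d / υ) * T ^ (d / υ)) := by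
  have hd' : (0 : ℝ) < d := by exact_mod_cast hd
  have hδ : 0 < d / υ := by positivity
  have hΓ := Real.Gamma_pos_of_pos hμ
  have hc : 0 ≤ ballConst d := by
    have := Real.Gamma_pos_of_pos (show (0 : ℝ) < 1 + (d : ℝ) / 2 by positivity)
    unfold ballConst
    positivity
  rw [Measure.prod_apply_symm (measurableSet_lossRegion d υ T)]
  have h : ∫⁻ y, volume ((fun x => (x, y)) ⁻¹' lossRegion d υ T) ∂alphaMuMeasure α μ w =
      ∫⁻ y, ENNReal.ofReal (ballConst d * T ^ (d / υ)) * ENNReal.ofReal (y ^ (d / υ))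
        ∂alphaMuMeasure α μ w := by
    refine lintegral_congr_ae ?_
    filter_upwards [ae_pos_alphaMuMeasure α μ w] with y hy
    exact volume_lossRegion_slice hd hυ hT hy
  rw [h, lintegral_const_mul _ (by fun_prop), lintegral_rpow_alphaMuMeasure hα hμ hw hδ.le,
    ← ENNReal.ofReal_mul (by positivity), ← ENNReal.ofReal_mul hlam, Ab1, Ab0]
  congr 1
  field_simp

/-! ### Almost sure exclusion of degenerate configurations. -/

section

variable {Ω : Type*} [MeasurableSpace Ω] {P : Measure Ω} [IsProbabilityMeasure P] {d : ℕ}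
  {X : ℕ → Ω → EuclideanSpace ℝ (Fin d)} {lam : ℝ} {g : ℕ → Ω → ℝ} {ν : Measure ℝ}

/-- The origin has volume zero, so its count is Poisson with mean `0`. At the origin, division by
zero would give capacity `0` rather than infinity. -/
lemma IsHPPP.ae_ne_zero (hX : IsHPPP P X lam) (hd : 1 ≤ d) : ∀ᵐ ω ∂P, ∀ i, X i ω ≠ 0 := by
  have : Nonempty (Fin d) := ⟨⟨0, hd⟩⟩
  have h := hX.count_law {0} (measurableSet_singleton 0) (by simp) 0
  simp only [measureReal_def, measure_singleton, ENNReal.toReal_zero, mul_zero, neg_zero,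
    Real.exp_zero, pow_zero, Nat.factorial_zero, Nat.cast_one, div_one, mul_one] at h
  have h1 : P {ω | pointCount X {0} ω = (0 : ℕ)} = 1 := by
    rw [← ENNReal.ofReal_toReal (measure_ne_top P _), h, ENNReal.ofReal_one]
  have hm : MeasurableSet {ω | pointCount X {0} ω = (0 : ℕ)} :=
    hX.measurable_pointCount (measurableSet_singleton 0) (measurableSet_singleton ((0 : ℕ) : ℕ∞))
  have h2 := (prob_compl_eq_zero_iff hm).2 h1
  filter_upwards [compl_mem_ae_iff.2 h2] with ω hω i hi
  rw [compl_compl, mem_ofPred_eq, pointCount, Nat.cast_zero, encard_eq_zero] at hω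
  exact (eq_empty_iff_forall_notMem.1 hω i) hi

/-- Almost surely no two path losses coincide. -/
lemma IsHPPP.ae_injective_pathLoss (hX : IsHPPP P X lam) (hd : 1 ≤ d) (υ : ℝ) [NullSingletonClass ν]
    (hg : ∀ i, Measurable (g i)) (hglaw : ∀ i, HasLaw (g i) ν P) (hgindep : iIndepFun g P)
    (hXg : IndepFun (fun ω i => X i ω) (fun ω i => g i ω) P) :
    ∀ᵐ ω ∂P, Function.Injective fun i => pathLoss X g υ i ω := by
  have : IsProbabilityMeasure ν :=
    (hglaw 0).map_eq ▸ Measure.isProbabilityMeasure_map (hg 0).aemeasurable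
  have key : ∀ i j, i ≠ j → ∀ᵐ ω ∂P, ¬ (X i ω ≠ 0 ∧ pathLoss X g υ i ω = pathLoss X g υ j ω) := by
    intro i j hij
    set A : Set ((ℕ → EuclideanSpace ℝ (Fin d)) × (ℕ → ℝ)) :=
      {z | z.1 i ≠ 0 ∧ ‖z.1 i‖ ^ υ / z.2 i = ‖z.1 j‖ ^ υ / z.2 j} with hA
    have hXi : ∀ i, Measurable fun z : (ℕ → EuclideanSpace ℝ (Fin d)) × (ℕ → ℝ) => z.1 i :=
      fun i => (measurable_pi_apply i).comp measurable_fst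
    have hgi : ∀ i, Measurable fun z : (ℕ → EuclideanSpace ℝ (Fin d)) × (ℕ → ℝ) => z.2 i :=
      fun i => (measurable_pi_apply i).comp measurable_snd
    have hAm : MeasurableSet A :=
      (hXi i (measurableSet_singleton 0).compl).inter
        (measurableSet_eq_fun (((hXi i).norm.pow_const υ).div (hgi i))
          (((hXi j).norm.pow_const υ).div (hgi j)))
    have h := lintegral_of_indepFun hX.measurable hg hXg
      (F := A.indicator fun _ => 1) (measurable_const.indicator hAm)
    have hinner : ∀ ω, ∫⁻ ω', A.indicator (fun _ => (1 : ℝ≥0∞))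
        (fun i => X i ω, fun i => g i ω') ∂P = 0 := by
      intro ω
      set c := ‖X i ω‖ ^ υ with hc
      set e := ‖X j ω‖ ^ υ with he
      by_cases h0 : X i ω = 0
      · simp [hA, indicator, h0]
      have hc0 : c ≠ 0 := (Real.rpow_pos_of_pos (norm_pos_iff.2 h0) υ).ne'
      set B : Set (ℝ × ℝ) := {p | c / p.2 = e / p.1} with hB
      have hBm : MeasurableSet B := measurableSet_eq_fun (by fun_prop) (by fun_prop)
      have hmap := (indepFun_iff_map_prod_eq_prod_map_map (hg j).aemeasurable
        (hg i).aemeasurable).1 (hgindep.indepFun hij.symm)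
      rw [(hglaw i).map_eq, (hglaw j).map_eq] at hmap
      -- With the positions and `g j` fixed, a tie forces a single value of `g i`, because `c ≠ 0`;
      -- the law `ν` gives it no mass.
      have hB0 : (ν.prod ν) B = 0 := by
        rw [Measure.measure_prod_null hBm]
        refine ae_of_all _ fun b => Subsingleton.measure_zero ?_ ν
        intro a ha a' ha'
        have h1 : c / a = e / b := ha
        have h2 : c / a' = e / b := ha'
        rw [← h2, div_eq_mul_inv, div_eq_mul_inv] at h1
        exact inv_injective (mul_left_cancel₀ hc0 h1)
      rw [← hmap, Measure.map_apply ((hg j).prodMk (hg i)) hBm] at hB0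
      have : (fun ω' => A.indicator (fun _ => (1 : ℝ≥0∞)) (fun i => X i ω, fun i => g i ω')) =
          ((fun ω' => (g j ω', g i ω')) ⁻¹' B).indicator fun _ => 1 := by
        funext ω'
        simp [indicator, hA, hB, h0, hc, he]
      rw [this, lintegral_indicator_const ((hg j).prodMk (hg i) hBm), hB0, mul_zero]
    simp only [hinner, lintegral_zero] at h
    have hTm : Measurable fun ω => ((fun i => X i ω, fun i => g i ω) :
        (ℕ → EuclideanSpace ℝ (Fin d)) × (ℕ → ℝ)) :=
      (measurable_pi_lambda _ hX.measurable).prodMk (measurable_pi_lambda _ hg)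
    have hae := (lintegral_eq_zero_iff ((measurable_const.indicator hAm).comp hTm)).1 h
    filter_upwards [hae] with ω hω hc
    have hmem : ((fun i => X i ω, fun i => g i ω) :
        (ℕ → EuclideanSpace ℝ (Fin d)) × (ℕ → ℝ)) ∈ A := hc
    rw [Function.comp_apply, indicator_of_mem hmem] at hω
    exact one_ne_zero hω
  have hall : ∀ᵐ ω ∂P, ∀ i j, i ≠ j →
      ¬ (X i ω ≠ 0 ∧ pathLoss X g υ i ω = pathLoss X g υ j ω) := by
    simp only [ae_all_iff]
    exact key
  filter_upwards [hall, hX.ae_ne_zero hd] with ω h1 h2 i j hij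
  by_contra hne
  exact h1 i j hne ⟨h2 i, hij⟩

end

/-- A capacity is below the rate iff the path loss exceeds the corresponding threshold. -/
lemma logb_capacity_lt_iff {η Rt r y : ℝ} (hη : 0 < η) (hRt : 0 < Rt) (hr : 0 < r) (hy : 0 < y) :
    Real.logb 2 (1 + η * y / r) < Rt ↔ ((2 ^ Rt - 1) / η)⁻¹ < r / y := by
  have h2 : (0 : ℝ) < 2 ^ Rt - 1 := sub_pos.2 (Real.one_lt_rpow one_lt_two hRt)
  rw [Real.logb_lt_iff_lt_rpow one_lt_two (by positivity), inv_div, div_lt_div_iff₀ h2 hy,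
    ← lt_sub_iff_add_lt', div_lt_iff₀ hr, mul_comm r]

end SecrecyCOP

end

/-! ### Outage probability of the `k`-th best receiver. -/

open SecrecyCOP in
theorem mainTheorem10 {Ω : Type*} [MeasurableSpace Ω] (P : Measure Ω) [IsProbabilityMeasure P]
    (d : ℕ) (hd : 1 ≤ d) (lam υ α μ w η : ℝ) (hlam : 0 < lam) (hυ : 0 < υ)
    (hα : 0 < α) (hμ : 0 < μ) (hw : 0 < w) (hη : 0 < η)
    (X : ℕ → Ω → EuclideanSpace ℝ (Fin d)) (g : ℕ → Ω → ℝ)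
    (hX : SecrecyCOP.IsHPPP P X lam)
    (hg : ∀ i, Measurable (g i))
    (hglaw : ∀ i, HasLaw (g i) (SecrecyCOP.alphaMuMeasure α μ w) P)
    (hgindep : iIndepFun g P)
    (hXg : IndepFun (fun ω i => X i ω) (fun ω i => g i ω) P)
    (k : ℕ) (hk : 1 ≤ k) (Rt : ℝ) (hRt : 0 < Rt)
    (δ Δ : ℝ) (hδ : δ = d / υ) (hΔ : Δ = (2 ^ Rt - 1) / η) :
    (∀ᵐ ω ∂P, ∃! i, SecrecyCOP.IsKthBest (fun j => SecrecyCOP.pathLoss X g υ j ω) k i) ∧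
    SecrecyCOP.copBest P X g υ η k Rt =
      SecrecyCOP.upperGamma k (SecrecyCOP.Ab1 d lam α μ w δ * Δ ^ (-δ)) / Real.Gamma k := by
  classical
  have hν : IsProbabilityMeasure (alphaMuMeasure α μ w) :=
    (hglaw 0).map_eq ▸ Measure.isProbabilityMeasure_map (hg 0).aemeasurable
  have hd' : (0 : ℝ) < d := by exact_mod_cast hd
  have hAb : 0 ≤ Ab1 d lam α μ w (d / υ) := by
    have h1 := Real.Gamma_pos_of_pos (show (0 : ℝ) < 1 + (d : ℝ) / 2 by positivity)
    have h2 := Real.Gamma_pos_of_pos hμ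
    have h3 : 0 < Real.Gamma (μ + 2 * (d / υ) / α) := Real.Gamma_pos_of_pos (by positivity)
    unfold Ab1 Ab0 ballConst
    positivity
  set N : ℝ → Ω → ℕ∞ := fun T ω => {i | pathLoss X g υ i ω ≤ T}.encard with hN
  have hNm : ∀ T, Measurable (N T) := fun T =>
    measurable_encard_setOf fun i =>
      (hX.measurable i).prodMk (hg i) (measurableSet_lossRegion d υ T)
  have hpois : ∀ T, 0 ≤ T → ∀ n : ℕ, P.real {ω | N T ω = n} =
      Real.exp (-(Ab1 d lam α μ w (d / υ) * T ^ (d / υ))) *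
        (Ab1 d lam α μ w (d / υ) * T ^ (d / υ)) ^ n / (n.factorial : ℝ) := fun T hT n =>
    hX.poisson_marked hlam.le hg hglaw hgindep hXg (measurableSet_lossRegion d υ T)
      (by positivity) (measure_lossRegion hd hlam.le hυ hT hα hμ hw) n
  have hfin : ∀ᵐ ω ∂P, ∀ n : ℕ, {i | pathLoss X g υ i ω ≤ n}.Finite := by
    rw [ae_all_iff]
    intro T
    filter_upwards [ae_ne_top_of_poisson (hNm T) (hpois T T.cast_nonneg)] with ω hω
    exact encard_ne_top_iff.1 hω
  have hinj := hX.ae_injective_pathLoss hd υ hg hglaw hgindep hXg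
  have hex : ∀ᵐ ω ∂P, ∃! i, IsKthBest (fun j => pathLoss X g υ j ω) k i := by
    filter_upwards [hfin, hinj] with ω h1 h2 using existsUnique_isKthBest h2 h1 hk
  refine ⟨hex, ?_⟩
  have hgpos : ∀ᵐ ω ∂P, ∀ i, 0 < g i ω := by
    rw [ae_all_iff]
    intro i
    have h := ae_pos_alphaMuMeasure α μ w
    rw [← (hglaw i).map_eq] at h
    exact ae_of_ae_map (hg i).aemeasurable h
  have h2 : (0 : ℝ) < 2 ^ Rt - 1 := sub_pos.2 (Real.one_lt_rpow one_lt_two hRt)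
  have hΔ0 : 0 < Δ := hΔ ▸ div_pos h2 hη
  -- Positive gains and nonzero positions make outage equivalent to a loss above `Δ⁻¹`, which the
  -- ranking converts to a count below `k`.
  have hset : {ω | ∃ i, IsKthBest (fun j => pathLoss X g υ j ω) k i ∧ capacity X g υ η i ω < Rt}
      =ᵐ[P] {ω | N Δ⁻¹ ω < k} := by
    rw [Filter.eventuallyEq_set]
    filter_upwards [hex, hgpos, hX.ae_ne_zero hd] with ω hω hgω hXω
    have hcap : ∀ i, capacity X g υ η i ω < Rt ↔ Δ⁻¹ < pathLoss X g υ i ω := fun i => by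
      rw [hΔ]
      exact logb_capacity_lt_iff hη hRt (Real.rpow_pos_of_pos (norm_pos_iff.2 (hXω i)) υ) (hgω i)
    constructor
    · rintro ⟨i, hi, hc⟩
      exact (hi.lt_iff Δ⁻¹).1 ((hcap i).1 hc)
    · intro hlt
      obtain ⟨i, hi, -⟩ := hω
      exact ⟨i, hi, (hcap i).2 ((hi.lt_iff Δ⁻¹).2 hlt)⟩
  have hun : {ω | N Δ⁻¹ ω < k} = ⋃ j ∈ Finset.range k, {ω | N Δ⁻¹ ω = j} := by
    ext ω
    simp only [mem_ofPred_eq, mem_iUnion, Finset.mem_range, exists_prop]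
    constructor
    · intro h
      obtain ⟨n, hn⟩ := ENat.ne_top_iff_exists.1 (h.trans_le le_top).ne
      rw [← hn] at h ⊢
      exact ⟨n, by exact_mod_cast h, rfl⟩
    · rintro ⟨n, hn, h⟩
      rw [h]
      exact_mod_cast hn
  have hfib : ∀ j : ℕ, MeasurableSet {ω | N Δ⁻¹ ω = j} := fun j =>
    hNm Δ⁻¹ (measurableSet_singleton (j : ℕ∞))
  rw [copBest, measureReal_congr hset, hun, measureReal_biUnion_finset
    (fun i _ j _ hij => by
      rw [Function.onFun, Set.disjoint_left]
      intro ω (hi : N Δ⁻¹ ω = i) (hj : N Δ⁻¹ ω = j)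
      exact hij (by exact_mod_cast hi.symm.trans hj))
    (fun j _ => hfib j),
    upperGamma_nat_div_Gamma hk (by rw [hδ]; positivity)]
  refine Finset.sum_congr rfl fun j _ => ?_
  rw [hpois _ (inv_nonneg.2 hΔ0.le), hδ, Real.inv_rpow hΔ0.le, Real.rpow_neg hΔ0.le]
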